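/- Let $\mathbb{H}=\{z\in\mathbb{C}:\operatorname{Im} z>0\}$. Let $\Phi:\mathbb{H}\to\mathbb{H}$ be analytic and of hyperbolic type with Denjoy–Wolff point at $\infty$ and dilation $A$, that is, $$A=\inf_{z\in\mathbb{H}}\frac{\operatorname{Im}\Phi(z)}{\operatorname{Im} z}>1 .$$ Say that a function $f$ on $\mathbb{H}$ has non-tangential limit $L$ at $\infty$ if, for every $\delta>0$, $f(z)\to L$ as $z\to\infty$ within the sector $\{z:|\operatorname{Arg} z-\pi/2|<\pi/2-\delta\}$. Let $\sigma:\mathbb{H}\to\mathbb{H}$ be analytic with $$\sigma\circ\Phi=A\sigma .$$ Then $\sigma$ has non-tangential limit $\infty$ at $\infty$, and $\sigma$ is semi-conformal at $\infty$, i.e. $\operatorname{Arg}\frac{\sigma(z)}{z}$ has non-tangential limit $0$ at $\infty$. Moreover, every analytic $\tilde\sigma:\mathbb{H}\to\mathbb{H}$ with $\tilde\sigma\circ\Phi=A\tilde\sigma$ is of the form $\tilde\sigma=c\,\sigma$ for some real constant $c>0$. -/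

import Mathlib

open Filter Topology UpperHalfPlane

/-- `f` restricts to an analytic self-map of the open upper half-plane `{z | 0 < im z}`
(the values of `f` outside the upper half-plane are irrelevant). -/
def IsAnalyticSelfMap (f : ℂ → ℂ) : Prop :=
  AnalyticOnNhd ℂ f upperHalfPlaneSet ∧ Set.MapsTo f upperHalfPlaneSet upperHalfPlaneSet

/-- `Φ` is a self-map of the upper half-plane of hyperbolic type, normalised so that its
Denjoy-Wolff point is `∞`, with dilation `A = inf (im Φ z / im z) > 1`. -/
def IsHyperbolicType (Φ : ℂ → ℂ) (A : ℝ) : Prop :=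
  IsAnalyticSelfMap Φ ∧ 1 < A ∧
    IsGLB ((fun z : ℂ => (Φ z).im / z.im) '' upperHalfPlaneSet) A

/-- The sector `|Arg z - π / 2| < π / 2 - δ`; for `δ > 0` it lies in the upper half-plane. -/
def sector (δ : ℝ) : Set ℂ :=
  {z : ℂ | |z.arg - Real.pi / 2| < Real.pi / 2 - δ}

/-- `f` has non-tangential limit at `∞` along the filter `l`: for every `δ > 0`, `f z` tends to `l`
as `z` tends to `∞` inside the sector `|Arg z - π / 2| < π / 2 - δ`. -/
def NonTangentialLimit {β : Type*} (f : ℂ → β) (l : Filter β) : Prop :=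
  ∀ δ : ℝ, 0 < δ → Tendsto f (Bornology.cobounded ℂ ⊓ 𝓟 (sector δ)) l

/-- `σ` is semi-conformal at `∞`: the argument of `σ z / z` has non-tangential limit `0`. -/
def IsSemiConformal (σ : ℂ → ℂ) : Prop :=
  NonTangentialLimit (fun z : ℂ => (σ z / z).arg) (𝓝 0)

/-- The functional equation `σ ∘ Φ = A σ` on the upper half-plane. -/
def Intertwines (σ Φ : ℂ → ℂ) (A : ℝ) : Prop :=
  ∀ z ∈ upperHalfPlaneSet, σ (Φ z) = (A : ℂ) * σ z

/-! Schwarz–Pick bounds the variation of a map into the closed half-plane by its imaginary part at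
one point and a hyperbolic distance (`norm_sub_le_im_mul_pickDistortion`). This yields both
`julia_wolff`, i.e. Φ z = A z + o(z) in sectors, and normality of rescaled families
(`exists_continuous_limit`).

An orbit of Φ stays in a sector and consecutive heights are comparable, so far-out points of a
sector lie at bounded hyperbolic distance from orbit points, where |σ| = Aⁿ|σ(i)|; hence σ → ∞. For
semi-conformality, limits of w ↦ σ(|ζ|w)/|σ ζ| commute with w ↦ A w, because Φ is asymptotically
that dilation. By `eq_real_mul_of_commutes_dilation` such a limit is a real dilation, and the
normalisation makes it the identity. For uniqueness, σ'/σ is Φ-invariant and its argument tends to 0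
along orbits, so it is positive, hence constant. -/

/-! ### Schwarz–Pick estimates on the half-plane. -/

/-- The Cayley transform centred at `w` in the upper half-plane has modulus below `1`. -/
theorem norm_sub_lt_norm_sub_conj {z w : ℂ} (hz : 0 < z.im) (hw : 0 < w.im) :
    ‖z - w‖ < ‖z - starRingEnd ℂ w‖ := by
  refine lt_of_pow_lt_pow_left₀ 2 (norm_nonneg _) ?_
  rw [← Complex.normSq_eq_norm_sq, ← Complex.normSq_eq_norm_sq, Complex.normSq_apply,
    Complex.normSq_apply]
  simp only [Complex.sub_re, Complex.sub_im, Complex.conj_re, Complex.conj_im]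
  nlinarith [mul_pos hz hw]

theorem norm_sub_conj_sq (z w : ℂ) :
    ‖z - starRingEnd ℂ w‖ ^ 2 = ‖z - w‖ ^ 2 + 4 * (z.im * w.im) := by
  rw [← Complex.normSq_eq_norm_sq, ← Complex.normSq_eq_norm_sq, Complex.normSq_apply,
    Complex.normSq_apply]
  simp only [Complex.sub_re, Complex.sub_im, Complex.conj_re, Complex.conj_im]
  ring

/-- The inverse Cayley transform maps the unit disc to the upper half-plane. -/
theorem inverse_cayley_im_pos {w ξ : ℂ} (hw : 0 < w.im) (hξ : ‖ξ‖ < 1) :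
    0 < ((w - starRingEnd ℂ w * ξ) / (1 - ξ)).im := by
  have hne : 1 - ξ ≠ 0 := by
    intro h
    rw [← sub_eq_zero.1 h] at hξ
    simp at hξ
  have hpos : 0 < Complex.normSq (1 - ξ) := Complex.normSq_pos.2 hne
  have hsq : ξ.re * ξ.re + ξ.im * ξ.im < 1 := by
    rw [← Complex.normSq_apply, Complex.normSq_eq_norm_sq]
    nlinarith [norm_nonneg ξ]
  have : ((w - starRingEnd ℂ w * ξ) / (1 - ξ)).im
      = w.im * (1 - (ξ.re * ξ.re + ξ.im * ξ.im)) / Complex.normSq (1 - ξ) := by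
    rw [Complex.div_im, ← sub_div]
    congr 1
    simp
    ring
  rw [this]
  exact div_pos (mul_pos hw (by linarith)) hpos

/-- Schwarz–Pick for analytic self-maps of the open upper half-plane. -/
theorem schwarz_pick_of_im_pos {f : ℂ → ℂ} (hd : DifferentiableOn ℂ f upperHalfPlaneSet)
    (hf : ∀ z ∈ upperHalfPlaneSet, 0 < (f z).im) {z w : ℂ} (hz : 0 < z.im) (hw : 0 < w.im) :
    ‖f z - f w‖ ^ 2 * (z.im * w.im) ≤ (f z).im * (f w).im * ‖z - w‖ ^ 2 := by
  -- `c` carries the disc to the half-plane with 0 ↦ w, and `g` is `f ∘ c` followed by the Cayley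
  -- transform at `f w`, so Schwarz's lemma applies to `g`.
  set c : ℂ → ℂ := fun ξ => (w - starRingEnd ℂ w * ξ) / (1 - ξ) with hc
  set g : ℂ → ℂ := fun ξ => (f (c ξ) - f w) / (f (c ξ) - starRingEnd ℂ (f w)) with hg
  have hne : ∀ ξ ∈ Metric.ball (0 : ℂ) 1, 1 - ξ ≠ 0 := by
    intro ξ hξ h
    rw [← sub_eq_zero.1 h] at hξ
    simp at hξ
  have hcm : Set.MapsTo c (Metric.ball 0 1) upperHalfPlaneSet := fun ξ hξ =>
    inverse_cayley_im_pos hw (by simpa using hξ)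
  have hcd : DifferentiableOn ℂ c (Metric.ball 0 1) := by
    apply DifferentiableOn.div (by fun_prop) (by fun_prop) hne
  have hfc := hd.comp hcd hcm
  have hlt : ∀ ξ ∈ Metric.ball (0 : ℂ) 1,
      ‖f (c ξ) - f w‖ < ‖f (c ξ) - starRingEnd ℂ (f w)‖ := fun ξ hξ =>
    norm_sub_lt_norm_sub_conj (hf _ (hcm hξ)) (hf w hw)
  have hgd : DifferentiableOn ℂ g (Metric.ball 0 1) := by
    refine DifferentiableOn.div (hfc.sub_const _) (hfc.sub_const _) fun ξ hξ => ?_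
    exact norm_pos_iff.1 ((norm_nonneg _).trans_lt (hlt ξ hξ))
  have hgm : Set.MapsTo g (Metric.ball 0 1) (Metric.closedBall 0 1) := by
    intro ξ hξ
    have := hlt ξ hξ
    rw [mem_closedBall_zero_iff, hg, norm_div]
    exact div_le_one_of_le₀ this.le (norm_nonneg _)
  have hc0 : c 0 = w := by simp [hc]
  have hg0 : g 0 = 0 := by simp [hg, hc0]
  have hzw := norm_sub_lt_norm_sub_conj hz hw
  have hzw0 : 0 < ‖z - starRingEnd ℂ w‖ := (norm_nonneg _).trans_lt hzw
  have hzw' : z - starRingEnd ℂ w ≠ 0 := norm_pos_iff.1 hzw0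
  set ξ := (z - w) / (z - starRingEnd ℂ w) with hξ
  have hξ1 : ‖ξ‖ < 1 := by
    rw [hξ, norm_div, div_lt_one hzw0]
    exact hzw
  have hww : w - starRingEnd ℂ w ≠ 0 := by
    intro h
    have := congrArg Complex.im h
    simp at this
    linarith
  have hcξ : c ξ = z := by
    have h1 : 1 - ξ = (w - starRingEnd ℂ w) / (z - starRingEnd ℂ w) := by
      rw [hξ]; field_simp; ring
    have h2 : w - starRingEnd ℂ w * ξ = z * ((w - starRingEnd ℂ w) / (z - starRingEnd ℂ w)) := by
      rw [hξ]; field_simp; ring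
    simp only [hc]
    rw [h2, h1]
    exact mul_div_cancel_right₀ _ (div_ne_zero hww hzw')
  have key := Complex.norm_le_norm_of_mapsTo_ball hgd hgm hg0 hξ1
  have hpos : 0 < ‖f z - starRingEnd ℂ (f w)‖ :=
    (norm_nonneg _).trans_lt (norm_sub_lt_norm_sub_conj (hf z hz) (hf w hw))
  simp only [hg, hcξ] at key
  rw [hξ, norm_div, norm_div, div_le_div_iff₀ hpos hzw0] at key
  have hsq := pow_le_pow_left₀ (by positivity) key 2
  -- The product of the two squared distances appears on both sides and cancels.
  rw [mul_pow, mul_pow, norm_sub_conj_sq, norm_sub_conj_sq] at hsq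
  linarith

/-- Schwarz–Pick for analytic maps of the upper half-plane into its closure. -/
theorem schwarz_pick {f : ℂ → ℂ} (hd : DifferentiableOn ℂ f upperHalfPlaneSet)
    (hf : ∀ z ∈ upperHalfPlaneSet, 0 ≤ (f z).im) {z w : ℂ} (hz : 0 < z.im) (hw : 0 < w.im) :
    ‖f z - f w‖ ^ 2 * (z.im * w.im) ≤ (f z).im * (f w).im * ‖z - w‖ ^ 2 := by
  have h : ∀ᶠ ε : ℝ in 𝓝[>] 0, ‖f z - f w‖ ^ 2 * (z.im * w.im) ≤
      ((f z).im + ε) * ((f w).im + ε) * ‖z - w‖ ^ 2 := by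
    filter_upwards [self_mem_nhdsWithin] with ε (hε : 0 < ε)
    have := schwarz_pick_of_im_pos (f := fun z => f z + ε * Complex.I) (hd.add_const _)
      (fun z hz => by simpa using add_pos_of_nonneg_of_pos (hf z hz) hε) hz hw
    simpa using this
  have ht : Tendsto (fun ε : ℝ => ((f z).im + ε) * ((f w).im + ε) * ‖z - w‖ ^ 2) (𝓝[>] 0)
      (𝓝 (((f z).im + 0) * ((f w).im + 0) * ‖z - w‖ ^ 2)) := by
    refine Tendsto.mono_left (Continuous.tendsto ?_ 0) nhdsWithin_le_nhds
    fun_prop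
  simpa using ge_of_tendsto ht h

/-- The distortion `K + √K` with `K = |z - w|² / (im z · im w)`; it controls the variation of
analytic functions with non-negative imaginary part. -/
noncomputable def pickDistortion (z w : ℂ) : ℝ :=
  ‖z - w‖ ^ 2 / (z.im * w.im) + √(‖z - w‖ ^ 2 / (z.im * w.im))

theorem pickDistortion_le {z w : ℂ} (h : 0 ≤ z.im * w.im) :
    pickDistortion z w ≤ 1 + 2 * (‖z - w‖ ^ 2 / (z.im * w.im)) := by
  have hK : 0 ≤ ‖z - w‖ ^ 2 / (z.im * w.im) := by positivity
  unfold pickDistortion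
  nlinarith [Real.sq_sqrt hK, sq_nonneg (√(‖z - w‖ ^ 2 / (z.im * w.im)) - 1)]

theorem pickDistortion_nonneg {z w : ℂ} (h : 0 ≤ z.im * w.im) : 0 ≤ pickDistortion z w := by
  unfold pickDistortion
  positivity

/-- With x = |f z - f w| and v = Im f w, Schwarz–Pick and Im f z ≤ x + v give x² ≤ (x + v)vK;
solving this quadratic inequality gives x ≤ v(K + √K). In particular `f` is constant if v = 0. -/
theorem norm_sub_le_im_mul_pickDistortion {f : ℂ → ℂ}
    (hd : DifferentiableOn ℂ f upperHalfPlaneSet)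
    (hf : ∀ z ∈ upperHalfPlaneSet, 0 ≤ (f z).im) {z w : ℂ} (hz : 0 < z.im) (hw : 0 < w.im) :
    ‖f z - f w‖ ≤ (f w).im * pickDistortion z w := by
  have h := schwarz_pick hd hf hz hw
  have hzw := mul_pos hz hw
  have hv : 0 ≤ (f w).im := hf w hw
  have him : (f z).im ≤ ‖f z - f w‖ + (f w).im := by
    have := (le_abs_self _).trans (Complex.abs_im_le_norm (f z - f w))
    rw [Complex.sub_im] at this
    linarith
  unfold pickDistortion
  set K := ‖z - w‖ ^ 2 / (z.im * w.im) with hKdef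
  have hK : 0 ≤ K := by positivity
  have hs := Real.sqrt_nonneg K
  have hs2 := Real.sq_sqrt hK
  have hx := norm_nonneg (f z - f w)
  have h1 : ‖f z - f w‖ ^ 2 ≤ (f z).im * (f w).im * K := by
    rw [hKdef, ← mul_div_assoc, le_div_iff₀ hzw]
    exact h
  have h2 : ‖f z - f w‖ ^ 2 ≤ (‖f z - f w‖ + (f w).im) * (f w).im * K :=
    h1.trans (by gcongr)
  by_contra! hlt
  set x := ‖f z - f w‖
  set v := (f w).im
  set s := √K
  have h3 : v * s ≤ x := by nlinarith [mul_nonneg hv hK]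
  have h4 : 0 ≤ (x - v * s) * (v * s) := mul_nonneg (by linarith) (by positivity)
  have hx0 : 0 < x := lt_of_le_of_lt (by positivity) hlt
  have h5 : 0 < x * (x - v * (K + s)) := mul_pos hx0 (by linarith)
  have h6 : v * s * (v * s) = v * v * K := by rw [← hs2]; ring
  nlinarith

/-! ### Julia–Wolff and maps commuting with a dilation. -/

/-- If `(f z).im / z.im` takes arbitrarily small values, then `f z = o(z)` in every sector. -/
theorem norm_le_mul_norm_of_im_small {f : ℂ → ℂ} (hd : DifferentiableOn ℂ f upperHalfPlaneSet)
    (hf : ∀ z ∈ upperHalfPlaneSet, 0 ≤ (f z).im)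
    (hsmall : ∀ ε > 0, ∃ z ∈ upperHalfPlaneSet, (f z).im ≤ ε * z.im) {k η : ℝ} (hk : 0 < k)
    (hη : 0 < η) :
    ∃ R : ℝ, ∀ z : ℂ, 0 < z.im → k * ‖z‖ ≤ z.im → R ≤ ‖z‖ → ‖f z‖ ≤ η * ‖z‖ := by
  -- Since |z - w|² ≤ 4|z|² and Im z ≥ k|z|, the quadratic part of the distortion contributes at
  -- most 8ε|z|/k, which is η|z|/2 for this ε. The radius makes the remaining 2|f w| at most η|z|/2.
  obtain ⟨w, hw, hfw⟩ := hsmall (η * k / 16) (by positivity)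
  have hw : 0 < w.im := hw
  refine ⟨max ‖w‖ (4 * ‖f w‖ / η), fun z hz hkz hR => ?_⟩
  have hzw : ‖w‖ ≤ ‖z‖ := (le_max_left _ _).trans hR
  have hzf : 4 * ‖f w‖ ≤ η * ‖z‖ := by
    have := (le_max_right _ _).trans hR
    rwa [div_le_iff₀ hη, mul_comm ‖z‖] at this
  have h1 := norm_sub_le_im_mul_pickDistortion hd hf hz hw
  have h2 := pickDistortion_le (mul_pos hz hw).le
  have hv := hf w hw
  have hvn : (f w).im ≤ ‖f w‖ := (le_abs_self _).trans (Complex.abs_im_le_norm _)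
  have h3 : ‖z - w‖ ^ 2 ≤ 4 * ‖z‖ ^ 2 := by
    have := norm_sub_le z w
    nlinarith [norm_nonneg (z - w), norm_nonneg z, norm_nonneg w]
  have h4 : (f w).im * (2 * (‖z - w‖ ^ 2 / (z.im * w.im))) ≤ η / 2 * ‖z‖ := by
    rw [mul_div_assoc', mul_div_assoc', div_le_iff₀ (mul_pos hz hw)]
    calc (f w).im * (2 * ‖z - w‖ ^ 2) ≤ (η * k / 16 * w.im) * (2 * (4 * ‖z‖ ^ 2)) := by gcongr
      _ = (η / 2 * ‖z‖) * ((k * ‖z‖) * w.im) := by ring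
      _ ≤ _ := by gcongr
  have h5 : ‖f z‖ ≤ ‖f w‖ + ‖f z - f w‖ := norm_le_norm_add_norm_sub' _ _
  have h6 := mul_le_mul_of_nonneg_left h2 hv
  linarith

/-- The Julia–Wolff theorem at `∞`: `f z = a z + o(z)` in every sector, where `a` is the infimum
of `(f z).im / z.im`. -/
theorem julia_wolff {f : ℂ → ℂ} {a : ℝ} (hd : DifferentiableOn ℂ f upperHalfPlaneSet)
    (ha : IsGLB ((fun z : ℂ => (f z).im / z.im) '' upperHalfPlaneSet) a) {k η : ℝ} (hk : 0 < k)
    (hη : 0 < η) :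
    ∃ R : ℝ, ∀ z : ℂ, 0 < z.im → k * ‖z‖ ≤ z.im → R ≤ ‖z‖ → ‖f z - a * z‖ ≤ η * ‖z‖ := by
  refine norm_le_mul_norm_of_im_small (f := fun z => f z - a * z) (by fun_prop) ?_ ?_ hk hη
  · intro z hz
    have h := ha.1 (Set.mem_image_of_mem _ hz)
    rw [le_div_iff₀ (show 0 < z.im from hz)] at h
    simpa using h
  · intro ε hε
    obtain ⟨_, ⟨z, hz, rfl⟩, -, hlt⟩ := ha.exists_between (lt_add_of_pos_right a hε)
    refine ⟨z, hz, ?_⟩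
    rw [div_lt_iff₀ (show 0 < z.im from hz)] at hlt
    simp
    linarith

/-- An analytic map of the upper half-plane to its closure that commutes with the dilation by
`A > 1` is a dilation. -/
theorem eq_real_mul_of_commutes_dilation {T : ℂ → ℂ} {A : ℝ} (hA : 1 < A)
    (hd : DifferentiableOn ℂ T upperHalfPlaneSet) (hT : ∀ z ∈ upperHalfPlaneSet, 0 ≤ (T z).im)
    (hTA : ∀ z ∈ upperHalfPlaneSet, T (A * z) = A * T z) :
    ∃ a : ℝ, 0 ≤ a ∧ ∀ z ∈ upperHalfPlaneSet, T z = a * z := by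
  set S := (fun z : ℂ => (T z).im / z.im) '' upperHalfPlaneSet
  have hS0 : ∀ x ∈ S, 0 ≤ x := by
    rintro _ ⟨z, hz, rfl⟩
    exact div_nonneg (hT z hz) (le_of_lt hz)
  have hSne : S.Nonempty := ⟨_, Complex.I, by simp [upperHalfPlaneSet], rfl⟩
  have hglb : IsGLB S (sInf S) := isGLB_csInf hSne ⟨0, hS0⟩
  refine ⟨sInf S, le_csInf hSne hS0, fun z (hz : 0 < z.im) => ?_⟩
  have hA0 : 0 < A := by linarith
  have hit : ∀ n : ℕ, 0 < ((A : ℂ) ^ n * z).im ∧ T ((A : ℂ) ^ n * z) = (A : ℂ) ^ n * T z := by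
    intro n
    induction n with
    | zero => simpa using hz
    | succ n ih =>
      rw [pow_succ', mul_assoc, hTA _ ih.1, ih.2, mul_assoc]
      refine ⟨?_, rfl⟩
      rw [Complex.im_ofReal_mul]
      exact mul_pos hA0 ih.1
  have hz0 : 0 < ‖z‖ := norm_pos_iff.2 fun h => by simp [h] at hz
  refine sub_eq_zero.1 (norm_le_zero_iff.1 (le_of_forall_pos_le_add fun ε hε => ?_))
  -- All points Aⁿz lie on one ray, and the error there is exactly Aⁿ(T z - a z), so the factor Aⁿ
  -- cancels from the o(Aⁿ) estimate.
  obtain ⟨R, hR⟩ := julia_wolff hd hglb (k := z.im / ‖z‖) (η := ε / ‖z‖) (by positivity)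
    (by positivity)
  obtain ⟨n, hn⟩ := pow_unbounded_of_one_lt (R / ‖z‖) hA
  have hAn : 0 < A ^ n := by positivity
  have hnorm : ‖(A : ℂ) ^ n‖ = A ^ n := by simp [abs_of_pos hA0]
  have himA : ((A : ℂ) ^ n * z).im = A ^ n * z.im := by
    rw [← Complex.ofReal_pow, Complex.im_ofReal_mul]
  have h := hR _ (hit n).1 (by
      rw [norm_mul, hnorm, himA]
      exact le_of_eq (by field_simp))
    (by rw [norm_mul, hnorm]; exact ((div_lt_iff₀ hz0).1 hn).le)
  rw [(hit n).2, show (A : ℂ) ^ n * T z - (sInf S : ℝ) * ((A : ℂ) ^ n * z)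
    = (A : ℂ) ^ n * (T z - (sInf S : ℝ) * z) by ring, norm_mul, norm_mul, hnorm] at h
  have h' : A ^ n * ‖T z - (sInf S : ℝ) * z‖ ≤ A ^ n * ε := by
    refine h.trans (le_of_eq (by field_simp))
  simpa using le_of_mul_le_mul_left h' hAn

/-! ### Normal families along an ultrafilter. -/

theorem tendsto_pickDistortion {ι : Type*} {l : Filter ι} {u v : ι → ℂ} {z w : ℂ}
    (hz : 0 < z.im) (hw : 0 < w.im) (hu : Tendsto u l (𝓝 z)) (hv : Tendsto v l (𝓝 w)) :
    Tendsto (fun i => pickDistortion (u i) (v i)) l (𝓝 (pickDistortion z w)) := by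
  have him : ∀ {x : ι → ℂ} {y : ℂ}, Tendsto x l (𝓝 y) →
      Tendsto (fun i => (x i).im) l (𝓝 y.im) := fun h =>
    (Complex.continuous_im.tendsto _).comp h
  have hK := ((hu.sub hv).norm.pow 2).div ((him hu).mul (him hv)) (mul_pos hz hw).ne'
  exact hK.add hK.sqrt

/-- A compactness principle: along an ultrafilter, analytic maps to the closed upper half-plane,
normalised at points converging inside the half-plane, converge continuously to an analytic
map. -/
theorem exists_continuous_limit {ι : Type*} (l : Ultrafilter ι) {F : ι → ℂ → ℂ} {e : ι → ℂ}
    {e₀ : ℂ} (he₀ : 0 < e₀.im) (he : Tendsto e l (𝓝 e₀))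
    (hd : ∀ᶠ i in (l : Filter ι), DifferentiableOn ℂ (F i) upperHalfPlaneSet)
    (hF : ∀ᶠ i in (l : Filter ι), ∀ z ∈ upperHalfPlaneSet, 0 ≤ (F i z).im)
    (hn : ∀ᶠ i in (l : Filter ι), ‖F i (e i)‖ = 1) :
    ∃ T : ℂ → ℂ, DifferentiableOn ℂ T upperHalfPlaneSet ∧
      (∀ z ∈ upperHalfPlaneSet, 0 ≤ (T z).im) ∧
      ∀ z ∈ upperHalfPlaneSet, ∀ u : ι → ℂ, Tendsto u l (𝓝 z) →
        Tendsto (fun i => F i (u i)) l (𝓝 (T z)) := by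
  have hupos : ∀ {z : ℂ} {u : ι → ℂ}, 0 < z.im → Tendsto u l (𝓝 z) →
      ∀ᶠ i in (l : Filter ι), 0 < (u i).im := fun hz hu =>
    hu.eventually (isOpen_upperHalfPlaneSet.mem_nhds hz)
  have hbound : ∀ z : ℂ, 0 < z.im → ∃ M : ℝ, 0 < M ∧ ∀ᶠ i in (l : Filter ι), ‖F i z‖ ≤ M := by
    intro z hz
    have hκ := (tendsto_pickDistortion hz he₀ tendsto_const_nhds he).eventually_lt_const
      (lt_add_one _)
    have hnn := pickDistortion_nonneg (mul_pos hz he₀).le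
    refine ⟨1 + (pickDistortion z e₀ + 1), by linarith, ?_⟩
    filter_upwards [hκ, hd, hF, hn, hupos he₀ he] with i h1 h2 h3 h4 h5
    have h6 := norm_sub_le_im_mul_pickDistortion h2 h3 hz h5
    have h7 : (F i (e i)).im ≤ 1 :=
      ((le_abs_self _).trans (Complex.abs_im_le_norm _)).trans h4.le
    have h8 := mul_le_mul_of_nonneg_right h7 (pickDistortion_nonneg (mul_pos hz h5).le)
    have h9 := norm_le_norm_add_norm_sub' (F i z) (F i (e i))
    linarith
  -- Equicontinuity at `z`, uniform in `i`: it turns pointwise limits into convergence along moving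
  -- points, hence locally uniform convergence.
  have hequi : ∀ z : ℂ, 0 < z.im → ∃ M : ℝ, 0 < M ∧ ∀ᶠ i in (l : Filter ι), ∀ y : ℂ, 0 < y.im →
      ‖F i y - F i z‖ ≤ M * pickDistortion y z := by
    intro z hz
    obtain ⟨M, hM0, hM⟩ := hbound z hz
    refine ⟨M, hM0, ?_⟩
    filter_upwards [hd, hF, hM] with i h2 h3 h4 y hy
    refine (norm_sub_le_im_mul_pickDistortion h2 h3 hy hz).trans
      (mul_le_mul_of_nonneg_right ?_ (pickDistortion_nonneg (mul_pos hy hz).le))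
    exact ((le_abs_self _).trans (Complex.abs_im_le_norm _)).trans h4
  have hlim : ∀ z : ℂ, ∃ t : ℂ, 0 < z.im → Tendsto (fun i => F i z) l (𝓝 t) := by
    intro z
    by_cases hz : 0 < z.im
    · obtain ⟨M, -, hM⟩ := hbound z hz
      obtain ⟨t, -, ht⟩ := (isCompact_closedBall (0 : ℂ) M).ultrafilter_le_nhds
        (l.map fun i => F i z) (by
          rw [le_principal_iff]
          show ∀ᶠ i in (l : Filter ι), F i z ∈ Metric.closedBall 0 M
          filter_upwards [hM] with i hi
          simpa using hi)
      exact ⟨t, fun _ => ht⟩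
    · exact ⟨0, fun h => absurd h hz⟩
  choose T hT using hlim
  have hzero : ∀ z : ℂ, 0 < z.im → Tendsto (fun y => pickDistortion y z) (𝓝 z) (𝓝 0) := by
    intro z hz
    have := tendsto_pickDistortion hz hz (tendsto_id (α := ℂ)) tendsto_const_nhds
    simpa [pickDistortion] using this
  have hTequi : ∀ z : ℂ, 0 < z.im → ∃ M : ℝ, 0 < M ∧ ∀ y : ℂ, 0 < y.im →
      ‖T y - T z‖ ≤ M * pickDistortion y z := by
    intro z hz
    obtain ⟨M, hM0, hM⟩ := hequi z hz
    refine ⟨M, hM0, fun y hy => le_of_tendsto ((hT y hy).sub (hT z hz)).norm ?_⟩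
    filter_upwards [hM] with i hi using hi y hy
  have hcont : ContinuousOn T upperHalfPlaneSet := by
    intro z hz
    refine ContinuousAt.continuousWithinAt ?_
    obtain ⟨M, -, hM⟩ := hTequi z hz
    rw [ContinuousAt, tendsto_iff_norm_sub_tendsto_zero]
    refine squeeze_zero' (.of_forall fun _ => norm_nonneg _)
      (eventually_of_mem (isOpen_upperHalfPlaneSet.mem_nhds hz) fun y hy => hM y hy) ?_
    simpa using (hzero z hz).const_mul M
  have hjoint : ∀ z : ℂ, 0 < z.im →
      Tendsto (fun p : ι × ℂ => F p.1 p.2) ((l : Filter ι) ×ˢ 𝓝 z) (𝓝 (T z)) := by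
    intro z hz
    obtain ⟨M, -, hM⟩ := hequi z hz
    have h1 : Tendsto (fun p : ι × ℂ => F p.1 p.2 - F p.1 z) ((l : Filter ι) ×ˢ 𝓝 z) (𝓝 0) := by
      rw [tendsto_zero_iff_norm_tendsto_zero]
      refine squeeze_zero' (.of_forall fun _ => norm_nonneg _)
        (g := fun p : ι × ℂ => M * pickDistortion p.2 z) ?_ ?_
      · filter_upwards [hM.prod_mk (isOpen_upperHalfPlaneSet.mem_nhds hz)] with p hp
          using hp.1 p.2 hp.2
      · simpa using ((hzero z hz).comp tendsto_snd).const_mul M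
    simpa using h1.add ((hT z hz).comp tendsto_fst)
  refine ⟨T, ?_, fun z hz => ?_, fun z hz u hu => (hjoint z hz).comp (tendsto_id.prodMk hu)⟩
  · refine TendstoLocallyUniformlyOn.differentiableOn (F := F) (φ := (l : Filter ι)) ?_ hd
      isOpen_upperHalfPlaneSet
    rw [isOpen_upperHalfPlaneSet.tendstoLocallyUniformlyOn_iff_forall_tendsto]
    intro z hz
    have h1 := (hcont.continuousAt (isOpen_upperHalfPlaneSet.mem_nhds hz)).tendsto.comp
      (tendsto_snd (f := (l : Filter ι)))
    exact (h1.prodMk_nhds (hjoint z hz)).mono_right (nhds_le_uniformity _)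
  · refine ge_of_tendsto ((Complex.continuous_im.tendsto _).comp (hT z hz)) ?_
    filter_upwards [hF] with i hi using hi z hz

/-! ### Sectors as cones k|z| ≤ Im z. -/

theorem sin_mul_norm_le_im_of_mem_sector {δ : ℝ} (hδ : 0 < δ) {z : ℂ} (hz : z ∈ sector δ) :
    0 < z.im ∧ 0 < Real.sin δ ∧ Real.sin δ * ‖z‖ ≤ z.im := by
  have hz' : |z.arg - Real.pi / 2| < Real.pi / 2 - δ := hz
  have hδ2 : δ < Real.pi / 2 := by linarith [abs_nonneg (z.arg - Real.pi / 2)]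
  have hpi := Real.pi_pos
  have hs : 0 < Real.sin δ := Real.sin_pos_of_pos_of_lt_pi hδ (by linarith)
  -- The convention arg 0 = 0 keeps the origin out of the sector.
  have hz0 : z ≠ 0 := by
    rintro rfl
    rw [Complex.arg_zero, zero_sub, abs_neg, abs_of_pos (by positivity)] at hz'
    linarith
  have h1 : Real.sin δ ≤ Real.sin z.arg := by
    rw [← Real.cos_pi_div_two_sub δ, ← Real.cos_sub_pi_div_two z.arg, ← Real.cos_abs (z.arg - _)]
    exact Real.cos_le_cos_of_nonneg_of_le_pi (abs_nonneg _) (by linarith) hz'.le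
  have h2 : Real.sin δ * ‖z‖ ≤ z.im := by
    rw [← Complex.norm_mul_sin_arg z, mul_comm]
    gcongr
  exact ⟨(mul_pos hs (norm_pos_iff.2 hz0)).trans_le h2, hs, h2⟩

theorem exists_mem_sector_of_mul_norm_le_im {k : ℝ} (hk : 0 < k) :
    ∃ δ : ℝ, 0 < δ ∧ ∀ z : ℂ, 0 < z.im → k * ‖z‖ ≤ z.im → z ∈ sector δ := by
  by_cases hk1 : k ≤ 1
  · have ha := Real.arcsin_pos.2 hk
    have hpi := Real.pi_pos
    -- Halving the angle makes the sector inequality strict on the boundary of the cone.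
    refine ⟨Real.arcsin k / 2, by positivity, fun z hz hkz => ?_⟩
    have hz0 : 0 < ‖z‖ := norm_pos_iff.2 fun h => by simp [h] at hz
    have hsin : k ≤ Real.sin z.arg := by
      rw [← Complex.norm_mul_sin_arg z, mul_comm k] at hkz
      exact le_of_mul_le_mul_left hkz hz0
    have harg0 : 0 ≤ z.arg := Complex.arg_nonneg_iff.2 hz.le
    have hargpi := Complex.arg_le_pi z
    have ha2 := Real.arcsin_le_pi_div_two k
    show |z.arg - Real.pi / 2| < Real.pi / 2 - Real.arcsin k / 2
    by_contra! hcon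
    have h1 := Real.cos_le_cos_of_nonneg_of_le_pi (by linarith)
      (abs_le.2 ⟨by linarith, by linarith⟩) hcon
    rw [Real.cos_abs, Real.cos_sub_pi_div_two, Real.cos_pi_div_two_sub] at h1
    have h2 : Real.sin (Real.arcsin k / 2) < Real.sin (Real.arcsin k) :=
      Real.sin_lt_sin_of_lt_of_le_pi_div_two (by linarith) ha2 (by linarith)
    rw [Real.sin_arcsin (by linarith) hk1] at h2
    linarith
  · refine ⟨1, one_pos, fun z hz hkz => ?_⟩
    have := (le_abs_self _).trans (Complex.abs_im_le_norm z)
    nlinarith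

/-! ### Self-maps and their orbits. -/

theorem IsAnalyticSelfMap.differentiableOn {f : ℂ → ℂ} (hf : IsAnalyticSelfMap f) :
    DifferentiableOn ℂ f upperHalfPlaneSet := hf.1.differentiableOn

theorem IsAnalyticSelfMap.im_nonneg {f : ℂ → ℂ} (hf : IsAnalyticSelfMap f) :
    ∀ z ∈ upperHalfPlaneSet, 0 ≤ (f z).im := fun _ hz => le_of_lt (hf.2 hz)

theorem IsAnalyticSelfMap.ne_zero {f : ℂ → ℂ} (hf : IsAnalyticSelfMap f) {z : ℂ}
    (hz : 0 < z.im) : f z ≠ 0 := by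
  intro h
  have : 0 < (f z).im := hf.2 hz
  simp [h] at this

theorem IsAnalyticSelfMap.iterate {f : ℂ → ℂ} (hf : IsAnalyticSelfMap f) (n : ℕ) :
    DifferentiableOn ℂ f^[n] upperHalfPlaneSet ∧
      Set.MapsTo f^[n] upperHalfPlaneSet upperHalfPlaneSet :=
  ⟨hf.differentiableOn.iterate hf.2 n, hf.2.iterate n⟩

/-- Orbits of a map of hyperbolic type escape to `∞` inside a sector, the imaginary parts growing
at least and at most geometrically. -/
theorem IsHyperbolicType.orbit {Φ : ℂ → ℂ} {A : ℝ} (hΦ : IsHyperbolicType Φ A) {z : ℂ}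
    (hz : 0 < z.im) :
    (∀ n, 0 < (Φ^[n] z).im) ∧ (∀ n, A * (Φ^[n] z).im ≤ (Φ^[n + 1] z).im) ∧
      (∀ n, A ^ n * z.im ≤ (Φ^[n] z).im) ∧
      (∃ C : ℝ, ∀ n, (Φ^[n + 1] z).im ≤ C * (Φ^[n] z).im) ∧
      ∃ k : ℝ, 0 < k ∧ ∀ n, k * ‖Φ^[n] z‖ ≤ (Φ^[n] z).im := by
  obtain ⟨hs, hA, hglb⟩ := hΦ
  have hpos : ∀ n, 0 < (Φ^[n] z).im := fun n => (hs.iterate n).2 hz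
  have hstep : ∀ n, A * (Φ^[n] z).im ≤ (Φ^[n + 1] z).im := by
    intro n
    rw [Function.iterate_succ_apply']
    exact (le_div_iff₀ (hpos n)).1 (hglb.1 (Set.mem_image_of_mem _ (hpos n)))
  have hpow : ∀ n, A ^ n * z.im ≤ (Φ^[n] z).im := by
    intro n
    induction n with
    | zero => simp
    | succ n ih =>
      refine le_trans ?_ (hstep n)
      rw [pow_succ', mul_assoc]
      gcongr
  set C := pickDistortion (Φ z) z
  have hΦz : 0 < (Φ z).im := hs.2 hz
  have hC : 0 ≤ C := pickDistortion_nonneg (mul_pos hΦz hz).le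
  have hdist : ∀ n, ‖Φ^[n + 1] z - Φ^[n] z‖ ≤ C * (Φ^[n] z).im := by
    intro n
    rw [Function.iterate_succ_apply, mul_comm]
    exact norm_sub_le_im_mul_pickDistortion (hs.iterate n).1
      (fun w hw => le_of_lt ((hs.iterate n).2 hw)) hΦz hz
  have hA1 : 0 < A - 1 := by linarith
  -- Steps have length at most C times the height, and heights grow by a factor at least A, so the
  -- steps sum like a geometric series.
  have hsum : ∀ n, ‖Φ^[n] z‖ ≤ ‖z‖ + C / (A - 1) * (Φ^[n] z).im := by
    intro n
    induction n with
    | zero => simpa using mul_nonneg (div_nonneg hC hA1.le) hz.le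
    | succ n ih =>
      have h1 := norm_le_norm_add_norm_sub' (Φ^[n + 1] z) (Φ^[n] z)
      have h2 := mul_le_mul_of_nonneg_left (hstep n) (div_nonneg hC hA1.le)
      have h3 : C / (A - 1) * (A * (Φ^[n] z).im)
          = C / (A - 1) * (Φ^[n] z).im + C * (Φ^[n] z).im := by
        field_simp
        ring
      linarith [hdist n]
  refine ⟨hpos, hstep, hpow, ⟨1 + C, fun n => ?_⟩, ?_⟩
  · have h1 := (le_abs_self _).trans (Complex.abs_im_le_norm (Φ^[n + 1] z - Φ^[n] z))
    rw [Complex.sub_im] at h1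
    linarith [hdist n]
  · have hD : 0 < ‖z‖ / z.im + C / (A - 1) := by
      have : 0 < ‖z‖ := norm_pos_iff.2 fun h => by simp [h] at hz
      positivity
    refine ⟨(‖z‖ / z.im + C / (A - 1))⁻¹, inv_pos.2 hD, fun n => ?_⟩
    rw [inv_mul_le_iff₀ hD]
    refine (hsum n).trans ?_
    rw [add_mul]
    gcongr
    rw [div_mul_eq_mul_div, le_div_iff₀ hz]
    gcongr
    refine le_trans ?_ (hpow n)
    exact le_mul_of_one_le_left hz.le (one_le_pow₀ hA.le)

theorem Intertwines.iterate {σ Φ : ℂ → ℂ} {A : ℝ} (h : Intertwines σ Φ A)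
    (hΦ : IsAnalyticSelfMap Φ) {z : ℂ} (hz : 0 < z.im) (n : ℕ) :
    σ (Φ^[n] z) = (A : ℂ) ^ n * σ z := by
  induction n with
  | zero => simp
  | succ n ih =>
    rw [Function.iterate_succ_apply', h _ ((hΦ.iterate n).2 hz), ih]
    ring

/-! ### Boundary behaviour of σ at ∞. -/

/-- An analytic solution of `σ ∘ Φ = A σ` tends to `∞` non-tangentially. -/
theorem nonTangentialLimit_cobounded {Φ σ : ℂ → ℂ} {A : ℝ} (hΦ : IsHyperbolicType Φ A)
    (hσ : IsAnalyticSelfMap σ) (hσΦ : Intertwines σ Φ A) :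
    NonTangentialLimit σ (Bornology.cobounded ℂ) := by
  intro δ hδ
  rw [← tendsto_norm_atTop_iff_cobounded, tendsto_atTop]
  intro B
  have hI : 0 < Complex.I.im := by simp
  obtain ⟨hpos, hstep, hpow, ⟨C, hC⟩, k, hk, hcone⟩ := hΦ.orbit hI
  set z : ℕ → ℂ := fun n => Φ^[n] Complex.I
  have hA : 1 < A := hΦ.2.1
  have hmono : Monotone fun n => (z n).im := monotone_nat_of_le_succ fun n =>
    (le_mul_of_one_le_left (hpos n).le hA.le).trans (hstep n)
  by_cases hs : 0 < Real.sin δ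
  swap
  · filter_upwards [mem_inf_of_right (mem_principal_self _)] with ζ hζ
    exact absurd (sin_mul_norm_le_im_of_mem_sector hδ hζ).2.1 hs
  set s := Real.sin δ
  set P := (k⁻¹ + s⁻¹) ^ 2 * C with hP
  have hC0 : 0 ≤ C := by
    have := (hpos 1).trans_le (hC 0)
    exact (pos_of_mul_pos_left this (hpos 0).le).le
  have hP0 : 0 ≤ P := by positivity
  have hσI : 0 < ‖σ Complex.I‖ := norm_pos_iff.2 (hσ.ne_zero hI)
  obtain ⟨N, hN⟩ := pow_unbounded_of_one_lt (B * (2 + 2 * P) / ‖σ Complex.I‖) hA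
  have hlarge : ∀ᶠ ζ in Bornology.cobounded ℂ, (z N).im / s ≤ ‖ζ‖ :=
    tendsto_norm_cobounded_atTop.eventually_ge_atTop _
  filter_upwards [mem_inf_of_right (mem_principal_self _), mem_inf_of_left hlarge] with ζ hζ hζN
  obtain ⟨hζ0, -, hζs⟩ := sin_mul_norm_le_im_of_mem_sector hδ hζ
  have hNζ : (z N).im ≤ ζ.im := by
    rw [div_le_iff₀ hs, mul_comm] at hζN
    exact hζN.trans hζs
  have hex : ∃ m, ζ.im < (z m).im := by
    obtain ⟨m, hm⟩ := pow_unbounded_of_one_lt ζ.im hA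
    exact ⟨m, hm.trans_le (by simpa using hpow m)⟩
  classical
  -- The last orbit point before the height of `ζ` is first exceeded; its height is within a factor
  -- `C` of that of `ζ`, and both points lie in fixed cones.
  obtain ⟨n, hNn, hn, hn1⟩ : ∃ n, N ≤ n ∧ (z n).im ≤ ζ.im ∧ ζ.im < (z (n + 1)).im := by
    have hm := Nat.find_spec hex
    have hmN : N < Nat.find hex := by
      by_contra! hle
      exact absurd (hm.trans_le (hmono hle)) (not_lt.2 hNζ)
    obtain ⟨n, hn⟩ := Nat.exists_eq_succ_of_ne_zero (Nat.ne_zero_of_lt hmN)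
    refine ⟨n, by omega, ?_, by rwa [hn] at hm⟩
    exact not_lt.1 (Nat.find_min hex (by omega))
  have hdist : ‖z n - ζ‖ ≤ (k⁻¹ + s⁻¹) * ζ.im := by
    have h1 : ‖z n‖ ≤ k⁻¹ * (z n).im := (le_inv_mul_iff₀ hk).2 (hcone n)
    have h2 : ‖ζ‖ ≤ s⁻¹ * ζ.im := (le_inv_mul_iff₀ hs).2 hζs
    have h3 : k⁻¹ * (z n).im ≤ k⁻¹ * ζ.im := by gcongr
    have := norm_sub_le (z n) ζ
    linarith
  have hK : ‖z n - ζ‖ ^ 2 / ((z n).im * ζ.im) ≤ P := by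
    rw [div_le_iff₀ (mul_pos (hpos n) hζ0)]
    calc ‖z n - ζ‖ ^ 2 ≤ ((k⁻¹ + s⁻¹) * ζ.im) ^ 2 := by gcongr
      _ = (k⁻¹ + s⁻¹) ^ 2 * ζ.im * ζ.im := by ring
      _ ≤ (k⁻¹ + s⁻¹) ^ 2 * (C * (z n).im) * ζ.im := by
        gcongr
        exact hn1.le.trans (hC n)
      _ = _ := by ring
  have hκ : pickDistortion (z n) ζ ≤ 1 + 2 * P :=
    (pickDistortion_le (mul_pos (hpos n) hζ0).le).trans (by linarith)
  have h1 := norm_sub_le_im_mul_pickDistortion hσ.differentiableOn hσ.im_nonneg (hpos n) hζ0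
  have h2 : (σ ζ).im ≤ ‖σ ζ‖ := (le_abs_self _).trans (Complex.abs_im_le_norm _)
  have h3 : (σ ζ).im * pickDistortion (z n) ζ ≤ ‖σ ζ‖ * (1 + 2 * P) :=
    mul_le_mul h2 hκ (pickDistortion_nonneg (mul_pos (hpos n) hζ0).le) (norm_nonneg _)
  have h4 := norm_le_norm_add_norm_sub' (σ (z n)) (σ ζ)
  have h5 : ‖σ (z n)‖ = A ^ n * ‖σ Complex.I‖ := by
    rw [hσΦ.iterate hΦ.1 hI, norm_mul, norm_pow, Complex.norm_real, Real.norm_eq_abs,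
      abs_of_pos (by linarith)]
  have h6 : B * (2 + 2 * P) < A ^ N * ‖σ Complex.I‖ := (div_lt_iff₀ hσI).1 hN
  have h7 : A ^ N * ‖σ Complex.I‖ ≤ A ^ n * ‖σ Complex.I‖ := by
    gcongr
    exact hA.le
  have h8 : B * (2 + 2 * P) ≤ ‖σ ζ‖ * (2 + 2 * P) := by linarith
  exact le_of_mul_le_mul_right h8 (by positivity)

/-- An analytic solution of `σ ∘ Φ = A σ` is semi-conformal at `∞`. -/
theorem isSemiConformal_of_intertwines {Φ σ : ℂ → ℂ} {A : ℝ} (hΦ : IsHyperbolicType Φ A)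
    (hσ : IsAnalyticSelfMap σ) (hσΦ : Intertwines σ Φ A) : IsSemiConformal σ := by
  intro δ hδ
  rw [tendsto_iff_ultrafilter]
  intro l hl
  have hA : 1 < A := hΦ.2.1
  have hsec : ∀ᶠ ζ in (l : Filter ℂ), ζ ∈ sector δ :=
    hl (mem_inf_of_right (mem_principal_self _))
  have hnorm : Tendsto (fun ζ : ℂ => ‖ζ‖) l atTop :=
    tendsto_norm_cobounded_atTop.mono_left (hl.trans inf_le_left)
  have hs : 0 < Real.sin δ := by
    obtain ⟨ζ, hζ⟩ := hsec.exists
    exact (sin_mul_norm_le_im_of_mem_sector hδ hζ).2.1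
  set s := Real.sin δ
  have hpos : ∀ᶠ ζ in (l : Filter ℂ), 0 < ‖ζ‖ := hnorm.eventually_gt_atTop 0
  have himdiv : ∀ ζ : ℂ, (ζ / (‖ζ‖ : ℂ)).im = ζ.im / ‖ζ‖ := fun ζ => Complex.div_ofReal_im _ _
  obtain ⟨e₀, he₀, he⟩ : ∃ e₀ : ℂ, (‖e₀‖ = 1 ∧ s ≤ e₀.im) ∧
      Tendsto (fun ζ : ℂ => ζ / (‖ζ‖ : ℂ)) l (𝓝 e₀) := by
    have hK : IsCompact (Metric.sphere (0 : ℂ) 1 ∩ {w : ℂ | s ≤ w.im}) :=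
      (isCompact_sphere _ _).inter_right (isClosed_le continuous_const Complex.continuous_im)
    obtain ⟨e₀, h1, h2⟩ := hK.ultrafilter_le_nhds (l.map fun ζ : ℂ => ζ / (‖ζ‖ : ℂ)) (by
      rw [le_principal_iff]
      show ∀ᶠ ζ : ℂ in (l : Filter ℂ),
        ζ / (‖ζ‖ : ℂ) ∈ Metric.sphere (0 : ℂ) 1 ∩ {w : ℂ | s ≤ w.im}
      filter_upwards [hsec, hpos] with ζ hζ hζ0
      refine ⟨by simp [hζ0.ne'], ?_⟩
      rw [Set.mem_ofPred_eq, himdiv, le_div_iff₀ hζ0]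
      exact (sin_mul_norm_le_im_of_mem_sector hδ hζ).2.2)
    exact ⟨e₀, ⟨by simpa using h1.1, h1.2⟩, h2⟩
  have he₀im : 0 < e₀.im := hs.trans_le he₀.2
  -- Blow-down of σ at scale |ζ|, normalised to modulus 1 at ζ/|ζ|.
  set F : ℂ → ℂ → ℂ := fun ζ w => σ ((‖ζ‖ : ℂ) * w) / (‖σ ζ‖ : ℂ) with hFdef
  have hmaps : ∀ ζ : ℂ, 0 < ‖ζ‖ →
      Set.MapsTo (fun w => (‖ζ‖ : ℂ) * w) upperHalfPlaneSet upperHalfPlaneSet := by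
    intro ζ hζ w hw
    show 0 < ((‖ζ‖ : ℂ) * w).im
    rw [Complex.im_ofReal_mul]
    exact mul_pos hζ hw
  have hFe : ∀ ζ : ℂ, 0 < ‖ζ‖ → F ζ (ζ / (‖ζ‖ : ℂ)) = σ ζ / (‖σ ζ‖ : ℂ) := by
    intro ζ hζ
    simp only [hFdef]
    rw [mul_div_cancel₀ _ (by exact_mod_cast hζ.ne')]
  have hFn : ∀ᶠ ζ : ℂ in (l : Filter ℂ), ‖F ζ (ζ / (‖ζ‖ : ℂ))‖ = 1 := by
    filter_upwards [hsec, hpos] with ζ hζ hζ0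
    have := norm_ne_zero_iff.2 (hσ.ne_zero (sin_mul_norm_le_im_of_mem_sector hδ hζ).1)
    rw [hFe ζ hζ0, norm_div, Complex.norm_real, norm_norm, div_self this]
  obtain ⟨T, hTd, hT0, hT⟩ := exists_continuous_limit l (F := F) he₀im he
    (by
      filter_upwards [hpos] with ζ hζ
      exact (hσ.differentiableOn.comp (by fun_prop) (hmaps ζ hζ)).div_const _)
    (by
      filter_upwards [hpos] with ζ hζ w hw
      simp only [hFdef]
      rw [Complex.div_ofReal_im]
      exact div_nonneg (hσ.im_nonneg _ (hmaps ζ hζ hw)) (norm_nonneg _)) hFn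
  have hTA : ∀ w ∈ upperHalfPlaneSet, T (A * w) = A * T w := by
    intro w (hw : 0 < w.im)
    have hw0 : 0 < ‖w‖ := norm_pos_iff.2 fun h => by simp [h] at hw
    have hAw : 0 < ((A : ℂ) * w).im := by
      rw [Complex.im_ofReal_mul]
      exact mul_pos (by linarith) hw
    have hu : Tendsto (fun ζ : ℂ => Φ ((‖ζ‖ : ℂ) * w) / (‖ζ‖ : ℂ)) l (𝓝 (A * w)) := by
      rw [Metric.tendsto_nhds]
      intro ε hε
      obtain ⟨R, hR⟩ := julia_wolff hΦ.1.differentiableOn hΦ.2.2 (k := w.im / ‖w‖)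
        (η := ε / 2 / ‖w‖) (by positivity) (by positivity)
      filter_upwards [hpos, hnorm.eventually_ge_atTop (R / ‖w‖)] with ζ hζ hζR
      have hn : ‖(‖ζ‖ : ℂ) * w‖ = ‖ζ‖ * ‖w‖ := by simp
      have h := hR ((‖ζ‖ : ℂ) * w) (hmaps ζ hζ hw)
        (by
          rw [hn, Complex.im_ofReal_mul]
          exact le_of_eq (by field_simp))
        (by rw [hn]; exact (div_le_iff₀ hw0).1 hζR)
      have hζc : (‖ζ‖ : ℂ) ≠ 0 := by exact_mod_cast hζ.ne'
      rw [dist_eq_norm, show Φ ((‖ζ‖ : ℂ) * w) / (‖ζ‖ : ℂ) - A * w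
        = (Φ ((‖ζ‖ : ℂ) * w) - A * ((‖ζ‖ : ℂ) * w)) / (‖ζ‖ : ℂ) by field_simp, norm_div,
        Complex.norm_real, norm_norm, div_lt_iff₀ hζ]
      refine h.trans_lt ?_
      rw [hn, show ε / 2 / ‖w‖ * (‖ζ‖ * ‖w‖) = ε / 2 * ‖ζ‖ by field_simp]
      gcongr
      linarith
    -- The moving points Φ(|ζ|w)/|ζ| tend to A w, and there the rescaled σ equals A times its value
    -- at w by the functional equation.
    refine tendsto_nhds_unique (hT _ hAw _ hu) ?_
    refine ((hT w hw _ tendsto_const_nhds).const_mul (A : ℂ)).congr' ?_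
    filter_upwards [hpos] with ζ hζ
    simp only [hFdef]
    rw [mul_div_cancel₀ _ (by exact_mod_cast hζ.ne'), hσΦ _ (hmaps ζ hζ hw), mul_div_assoc]
  obtain ⟨a, ha, hTa⟩ := eq_real_mul_of_commutes_dilation hA hTd hT0 hTA
  have hlim := hT e₀ he₀im _ he
  have ha1 : a = 1 := by
    have h1 : Tendsto (fun ζ : ℂ => ‖F ζ (ζ / (‖ζ‖ : ℂ))‖) l (𝓝 1) :=
      tendsto_const_nhds.congr' (hFn.mono fun ζ h => h.symm)
    have h2 := tendsto_nhds_unique hlim.norm h1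
    rw [hTa e₀ he₀im, norm_mul, he₀.1, Complex.norm_real, Real.norm_eq_abs, abs_of_nonneg ha] at h2
    linarith
  have he₀ne : e₀ ≠ 0 := norm_ne_zero_iff.1 (by rw [he₀.1]; exact one_ne_zero)
  have hquot := hlim.div he he₀ne
  rw [hTa e₀ he₀im, ha1, Complex.ofReal_one, one_mul, div_self he₀ne] at hquot
  have harg := (Complex.continuousAt_arg Complex.one_mem_slitPlane).tendsto.comp hquot
  rw [Complex.arg_one] at harg
  refine harg.congr' ?_
  filter_upwards [hsec, hpos] with ζ hζ hζ0
  have hσ0 : 0 < ‖σ ζ‖ :=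
    norm_pos_iff.2 (hσ.ne_zero (sin_mul_norm_le_im_of_mem_sector hδ hζ).1)
  have hζc : (‖ζ‖ : ℂ) ≠ 0 := by exact_mod_cast hζ0.ne'
  have hσc : (‖σ ζ‖ : ℂ) ≠ 0 := by exact_mod_cast hσ0.ne'
  have hζne : ζ ≠ 0 := norm_pos_iff.1 hζ0
  show (F ζ (ζ / (‖ζ‖ : ℂ)) / (ζ / (‖ζ‖ : ℂ))).arg = (σ ζ / ζ).arg
  rw [hFe ζ hζ0, show σ ζ / (‖σ ζ‖ : ℂ) / (ζ / (‖ζ‖ : ℂ))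
    = ((‖ζ‖ / ‖σ ζ‖ : ℝ) : ℂ) * (σ ζ / ζ) by push_cast; field_simp,
    Complex.arg_real_mul _ (by positivity)]

/-! ### Uniqueness up to a positive factor. -/

/-- Along an orbit, `σ z / z` becomes positive up to a rotation tending to the identity. -/
theorem IsSemiConformal.tendsto_orbit {Φ σ : ℂ → ℂ} {A : ℝ} (hΦ : IsHyperbolicType Φ A)
    (hσ : IsSemiConformal σ) {z : ℂ} (hz : 0 < z.im) :
    Tendsto (fun n => Complex.exp ((σ (Φ^[n] z) / Φ^[n] z).arg * Complex.I)) atTop (𝓝 1) := by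
  obtain ⟨hpos, -, hpow, -, k, hk, hcone⟩ := hΦ.orbit hz
  obtain ⟨δ, hδ, hsec⟩ := exists_mem_sector_of_mul_norm_le_im hk
  have hinf : Tendsto (fun n => Φ^[n] z) atTop (Bornology.cobounded ℂ) := by
    rw [← tendsto_norm_atTop_iff_cobounded]
    refine tendsto_atTop_mono (fun n => (hpow n).trans
      ((le_abs_self _).trans (Complex.abs_im_le_norm _))) ?_
    exact (tendsto_pow_atTop_atTop_of_one_lt hΦ.2.1).atTop_mul_const hz
  have h1 := (hσ δ hδ).comp (tendsto_inf.2 ⟨hinf, tendsto_principal.2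
    (.of_forall fun n => hsec _ (hpos n) (hcone n))⟩)
  have hc : Continuous fun t : ℝ => Complex.exp (t * Complex.I) := by fun_prop
  simpa [Function.comp_def] using (hc.tendsto 0).comp h1

/-- Two analytic solutions of `σ ∘ Φ = A σ` are positive multiples of each other. -/
theorem exists_pos_mul_of_intertwines {Φ σ σ' : ℂ → ℂ} {A : ℝ} (hΦ : IsHyperbolicType Φ A)
    (hσ : IsAnalyticSelfMap σ) (hσΦ : Intertwines σ Φ A) (hσ' : IsAnalyticSelfMap σ')
    (hσΦ' : Intertwines σ' Φ A) :
    ∃ c : ℝ, 0 < c ∧ ∀ z ∈ upperHalfPlaneSet, σ' z = (c : ℂ) * σ z := by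
  set h : ℂ → ℂ := fun z => σ' z / σ z with hh
  have hd : DifferentiableOn ℂ h upperHalfPlaneSet :=
    hσ'.differentiableOn.div hσ.differentiableOn fun z hz => hσ.ne_zero hz
  have hexp : ∀ w : ℂ, w ≠ 0 → Complex.exp (w.arg * Complex.I) = w / (‖w‖ : ℂ) := by
    intro w hw
    rw [eq_div_iff (by exact_mod_cast norm_ne_zero_iff.2 hw), mul_comm]
    exact Complex.norm_mul_exp_arg_mul_I w
  have hreal : ∀ z : ℂ, 0 < z.im → h z = (‖h z‖ : ℂ) := by
    intro z hz
    have h1 := (isSemiConformal_of_intertwines hΦ hσ hσΦ).tendsto_orbit hΦ hz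
    have h2 := (isSemiConformal_of_intertwines hΦ hσ' hσΦ').tendsto_orbit hΦ hz
    have h3 := h2.div h1 one_ne_zero
    have h0 : h z ≠ 0 := div_ne_zero (hσ'.ne_zero hz) (hσ.ne_zero hz)
    -- The quotient of phases is the phase of the Φ-invariant function `h`, so it does not depend on
    -- n.
    have hconst : ∀ n, Complex.exp ((σ' (Φ^[n] z) / Φ^[n] z).arg * Complex.I) /
        Complex.exp ((σ (Φ^[n] z) / Φ^[n] z).arg * Complex.I) = h z / (‖h z‖ : ℂ) := by
      intro n
      have hn : 0 < (Φ^[n] z).im := (hΦ.1.iterate n).2 hz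
      have hn0 : Φ^[n] z ≠ 0 := fun h => by simp [h] at hn
      have hA : (A : ℂ) ^ n ≠ 0 := pow_ne_zero _ (by exact_mod_cast (zero_lt_one.trans hΦ.2.1).ne')
      have hs := hσ.ne_zero hn
      have hs' := hσ'.ne_zero hn
      have hinv : h z = σ' (Φ^[n] z) / σ (Φ^[n] z) := by
        rw [hσΦ.iterate hΦ.1 hz, hσΦ'.iterate hΦ.1 hz, mul_div_mul_left _ _ hA]
      have hc : ∀ {w : ℂ}, w ≠ 0 → (‖w‖ : ℂ) ≠ 0 := fun hw => by
        exact_mod_cast norm_ne_zero_iff.2 hw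
      have e1 := hc hn0
      have e2 := hc hs
      have e3 := hc hs'
      rw [hexp _ (div_ne_zero hs' hn0), hexp _ (div_ne_zero hs hn0), hinv, norm_div, norm_div,
        norm_div]
      push_cast
      field_simp
    have h4 : h z / (‖h z‖ : ℂ) = 1 := by
      rw [div_one] at h3
      exact tendsto_nhds_unique (tendsto_const_nhds.congr fun n => (hconst n).symm) h3
    rwa [div_eq_one_iff_eq (by exact_mod_cast norm_ne_zero_iff.2 h0)] at h4
  have him : ∀ z : ℂ, 0 < z.im → (h z).im = 0 := fun z hz => by
    rw [hreal z hz, Complex.ofReal_im]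
  have hI : 0 < Complex.I.im := by simp
  refine ⟨‖h Complex.I‖, norm_pos_iff.2 (div_ne_zero (hσ'.ne_zero hI) (hσ.ne_zero hI)),
    fun z (hz : 0 < z.im) => ?_⟩
  -- A real-valued `h` still maps into the closed half-plane, and its zero imaginary part at i makes
  -- the bound vanish.
  have h1 := norm_sub_le_im_mul_pickDistortion hd (fun w hw => (him w hw).ge) hz hI
  rw [him _ hI, zero_mul, norm_le_zero_iff, sub_eq_zero] at h1
  rw [← hreal _ hI, ← h1, div_mul_cancel₀ _ (hσ.ne_zero hz)]

theorem proposition2 (Φ : ℂ → ℂ) (A : ℝ) (hΦ : IsHyperbolicType Φ A)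
    (σ : ℂ → ℂ) (hσ : IsAnalyticSelfMap σ) (hσΦ : Intertwines σ Φ A) :
    NonTangentialLimit σ (Bornology.cobounded ℂ) ∧
    IsSemiConformal σ ∧
    ∀ σ' : ℂ → ℂ, IsAnalyticSelfMap σ' → Intertwines σ' Φ A →
      ∃ c : ℝ, 0 < c ∧ ∀ z ∈ upperHalfPlaneSet, σ' z = (c : ℂ) * σ z :=
  ⟨nonTangentialLimit_cobounded hΦ hσ hσΦ, isSemiConformal_of_intertwines hΦ hσ hσΦ,
    fun _ hσ' hσΦ' => exists_pos_mul_of_intertwines hΦ hσ hσΦ hσ' hσΦ'⟩
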